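/- Let \(\mathcal K\) be a locally finitely presentable category and let \(\mathcal L\subseteq\mathcal K\) be a definable subcategory, that is, a full subcategory closed in \(\mathcal K\) under small products, directed colimits and pure subobjects. Here a morphism \(f:A\to B\) of \(\mathcal K\) is pure if for every commutative square \(f u=t g\) with \(g:A'\to B'\), \(A'\) and \(B'\) finitely presentable, the morphism \(u:A'\to A\) factors through \(g\); a pure subobject is one represented by a pure monomorphism. Let \(\mathcal L^+\) be the category of all functors \(\mathcal L\to\mathbf{Set}\) that preserve small products and directed colimits, with all natural transformations as morphisms. Then for every \(X\in\mathcal L^+\) there are a finitely presentable object \(K\) of \(\mathcal K\), such that the restricted representable functor \(\mathcal K(K,-)|_{\mathcal L}\) belongs to \(\mathcal L^+\), and a natural transformation \(\eta:\mathcal K(K,-)|_{\mathcal L}\to X\) that is a regular epimorphism in \(\mathcal L^+\) and whose components \(\eta_L:\mathcal K(K,L)\to X(L)\) are surjective for all \(L\in\mathcal L\). -/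

import Mathlib

open CategoryTheory Limits Opposite

universe w v u

namespace DefinableCategories

/-- A morphism `f : A ⟶ B` is *pure* if, for every commutative square `u ≫ f = g ≫ t` whose left
side `g : A' ⟶ B'` has finitely presentable domain and codomain, `u` factors through `g`. -/
def IsPure {C : Type u} [Category.{w} C] {A B : C} (f : A ⟶ B) : Prop :=
  ∀ ⦃A' B' : C⦄, IsFinitelyPresentable.{w} A' → IsFinitelyPresentable.{w} B' →
    ∀ (g : A' ⟶ B') (u : A' ⟶ A) (t : B' ⟶ B), u ≫ f = g ≫ t → ∃ d : B' ⟶ A, g ≫ d = u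

/-- The full subcategory of `C` given by the property of objects `P` is *definable*:
it is closed in `C` under (small) products, directed colimits and pure subobjects. -/
structure IsDefinableSubcategory {C : Type u} [Category.{w} C] (P : ObjectProperty C) : Prop where
  products : ∀ (I : Type w), P.IsClosedUnderLimitsOfShape (Discrete I)
  directedColimits : ∀ (I : Type w) [PartialOrder I] [IsDirectedOrder I] [Nonempty I],
    P.IsClosedUnderColimitsOfShape I
  pureSubobjects : ∀ ⦃A B : C⦄ (f : A ⟶ B), Mono f → IsPure f → P B → P A

/-- The functor `F : D ⥤ Set` preserves (small) products and directed colimits. -/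
structure PreservesProductsAndDirectedColimits {D : Type u} [Category.{v} D]
    (F : D ⥤ Type w) : Prop where
  products : ∀ (I : Type w), PreservesLimitsOfShape (Discrete I) F
  directedColimits : ∀ (I : Type w) [PartialOrder I] [IsDirectedOrder I] [Nonempty I],
    PreservesColimitsOfShape I F

/-- The category `D⁺` of functors `D ⥤ Set` preserving products and directed colimits, with all
natural transformations as morphisms. -/
abbrev Plus (D : Type u) [Category.{v} D] :=
  ObjectProperty.FullSubcategory
    (fun F : D ⥤ Type w => PreservesProductsAndDirectedColimits.{w} F)

/-- The functor `C(A, -)|_L`, where `L` is the full subcategory of `C` given by `P`. -/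
abbrev restrictedHom {C : Type u} [Category.{w} C] (P : ObjectProperty C) (A : C) :
    P.FullSubcategory ⥤ Type w :=
  P.ι ⋙ coyoneda.obj (op A)

end DefinableCategories

/-! Every object of `C` is a directed colimit, along pure maps, of objects from one essentially
small class (`exists_directed_colimit_isPure`, a downward Löwenheim–Skolem argument). For objects of
`P` the pieces stay in `P`, so a product over the pieces and their elements carries a weakly initial
element `x` of `X`, at some `M` (`exists_weaklyInitial`). Applied to restricted representables, this
gives weak reflections of finitely presentable objects.

Write `M` as a directed colimit of finitely presentable `K k`, with weak reflections `r k : K k ⟶ N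
k`. The `r k` induce a map from `M` to the reduced product of the `N k` modulo tails. As `X`
preserves reduced products, the image of `x` is the germ of a family `y k`. Maps out of the `N k`
that agree after `r k` induce the same map out of `M`, so they eventually agree on `y k`; extending
the coprojections to maps `N k ⟶ M` gives the diagonal, so these eventually send `y k` to `x`
(`exists_element`). For a suitable `k`, sending `r k ≫ a` to `X.map a (y k)` is then well defined
and has `x` in its image, hence is surjective. It is the coequalizer of its kernel pair, which again
lies in the category `Plus`. -/

namespace DefinableCategories

/-! ### Subsets generated under binary operations -/

section Tree

/-- Terms in countably many variables and a family, indexed by `A`, of binary operations. -/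
inductive Tree (A : Type w) : Type w
  | var : ℕ → Tree A
  | node : A → Tree A → Tree A → Tree A

variable {A J : Type w} (op : A → J → J → J)

/-- The value of a term at an assignment of the variables. -/
def Tree.eval (s : ℕ → J) : Tree A → J
  | var n => s n
  | node a t t' => op a (t.eval s) (t'.eval s)

/-- The subset generated by a sequence. -/
def generated (s : ℕ → J) : Set J := Set.range (Tree.eval op s)

lemma mem_generated (s : ℕ → J) (n : ℕ) : s n ∈ generated op s := ⟨.var n, rfl⟩

lemma op_mem_generated (s : ℕ → J) (a : A) {i j : J} (hi : i ∈ generated op s)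
    (hj : j ∈ generated op s) : op a i j ∈ generated op s := by
  obtain ⟨t, rfl⟩ := hi
  obtain ⟨t', rfl⟩ := hj
  exact ⟨.node a t t', rfl⟩

lemma generated_subset (s s' : ℕ → J) (h : ∀ n, s n ∈ generated op s') :
    generated op s ⊆ generated op s' := by
  rintro _ ⟨t, rfl⟩
  induction t with
  | var n => exact h n
  | node a t t' ht ht' => exact op_mem_generated op s' a ht ht'

/-- The poset of countably generated subsets. -/
abbrev GeneratedSubset : Type w := { Z : Set J // ∃ s, Z = generated op s }

instance : IsDirectedOrder (GeneratedSubset op) where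
  directed := by
    rintro ⟨_, s, rfl⟩ ⟨_, s', rfl⟩
    let s'' : ℕ → J := Sum.elim s s' ∘ Equiv.natSumNatEquivNat.symm
    refine ⟨⟨_, s'', rfl⟩, generated_subset op _ _ fun n ↦ ?_, generated_subset op _ _ fun n ↦ ?_⟩
    · simpa [s''] using mem_generated op s'' (Equiv.natSumNatEquivNat (.inl n))
    · simpa [s''] using mem_generated op s'' (Equiv.natSumNatEquivNat (.inr n))

end Tree

variable {C : Type u} [Category.{v} C]

/-! ### Colimits over subsets of a poset -/

section Restriction

variable {J : Type w} [PartialOrder J]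

/-- A cocone over a diagram indexed by a poset. -/
@[simps]
def coconeOfLE (F : J ⥤ C) (X : C) (α : ∀ j, F.obj j ⟶ X)
    (h : ∀ i j (hij : i ≤ j), F.map (homOfLE hij) ≫ α j = α i) : Cocone F where
  pt := X
  ι :=
    { app := α
      naturality i j f := (h i j (leOfHom f)).trans (Category.comp_id _).symm }

/-- The restriction of a diagram indexed by a poset to a subset. -/
def restrictDiagram (F : J ⥤ C) (Z : Set J) : Z ⥤ C where
  obj j := F.obj j.1
  map f := F.map (homOfLE (leOfHom f))
  map_id _ := F.map_id _
  map_comp _ _ := by rw [← F.map_comp]; rfl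

variable [HasColimitsOfSize.{w, w} C]

/-- The colimit of the restriction of a diagram indexed by a poset to a subset. -/
noncomputable def restrictColimit (F : J ⥤ C) (Z : Set J) : C :=
  colimit (restrictDiagram F Z)

variable {F : J ⥤ C}

/-- The coprojections to the colimit of a restricted diagram. -/
noncomputable def restrictι (F : J ⥤ C) {Z : Set J} (j : J) (hj : j ∈ Z) :
    F.obj j ⟶ restrictColimit F Z :=
  colimit.ι (restrictDiagram F Z) ⟨j, hj⟩

@[simp]
lemma map_restrictι {Z : Set J} {i j : J} (hi : i ∈ Z) (hj : j ∈ Z) (f : i ⟶ j) :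
    F.map f ≫ restrictι F j hj = restrictι F i hi :=
  colimit.w (restrictDiagram F Z) (homOfLE (leOfHom f) : (⟨i, hi⟩ : Z) ⟶ ⟨j, hj⟩)

lemma restrictColimit_hom_ext {Z : Set J} {X : C} {f g : restrictColimit F Z ⟶ X}
    (h : ∀ j (hj : j ∈ Z), restrictι F j hj ≫ f = restrictι F j hj ≫ g) : f = g :=
  colimit.hom_ext fun j ↦ h j.1 j.2

lemma map_restrictι_assoc {Z : Set J} {i j : J} (hi : i ∈ Z) (hj : j ∈ Z) (f : i ⟶ j) {X : C}
    (g : restrictColimit F Z ⟶ X) :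
    F.map f ≫ restrictι F j hj ≫ g = restrictι F i hi ≫ g := by
  rw [← map_restrictι hi hj f, Category.assoc]

/-- Morphisms from the colimit of a restricted diagram. -/
noncomputable def restrictDesc {Z : Set J} {X : C} (α : ∀ j ∈ Z, F.obj j ⟶ X)
    (h : ∀ i hi j hj (hij : i ≤ j), F.map (homOfLE hij) ≫ α j hj = α i hi) :
    restrictColimit F Z ⟶ X :=
  colimit.desc (restrictDiagram F Z)
    (coconeOfLE (restrictDiagram F Z) X (fun j ↦ α j.1 j.2)
      fun i j hij ↦ h i.1 i.2 j.1 j.2 hij)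

@[simp]
lemma restrictι_restrictDesc {Z : Set J} {X : C} (α : ∀ j ∈ Z, F.obj j ⟶ X)
    (h : ∀ i hi j hj (hij : i ≤ j), F.map (homOfLE hij) ≫ α j hj = α i hi) (j : J) (hj : j ∈ Z) :
    restrictι F j hj ≫ restrictDesc α h = α j hj :=
  colimit.ι_desc _ _

/-- The canonical map between colimits of restricted diagrams. -/
noncomputable def restrictionMap (F : J ⥤ C) {Z Z' : Set J} (h : Z ⊆ Z') :
    restrictColimit F Z ⟶ restrictColimit F Z' :=
  restrictDesc (fun j hj ↦ restrictι F j (h hj)) (fun _ _ _ _ _ ↦ map_restrictι _ _ _)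

@[simp]
lemma restrictι_restrictionMap {Z Z' : Set J} (h : Z ⊆ Z') (j : J) (hj : j ∈ Z) :
    restrictι F j hj ≫ restrictionMap F h = restrictι F j (h hj) :=
  restrictι_restrictDesc _ _ _ _

lemma restrictι_restrictionMap_assoc {Z Z' : Set J} (h : Z ⊆ Z') (j : J) (hj : j ∈ Z) {X : C}
    (g : restrictColimit F Z' ⟶ X) :
    restrictι F j hj ≫ restrictionMap F h ≫ g = restrictι F j (h hj) ≫ g := by
  rw [← restrictι_restrictionMap h j hj, Category.assoc]

variable (c : Cocone F)

/-- The comparison map from the colimit of a restricted diagram. -/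
noncomputable def fromRestriction (Z : Set J) : restrictColimit F Z ⟶ c.pt :=
  restrictDesc (fun j _ ↦ c.ι.app j) (fun _ _ _ _ _ ↦ c.w _)

@[simp]
lemma restrictι_fromRestriction (Z : Set J) (j : J) (hj : j ∈ Z) :
    restrictι F j hj ≫ fromRestriction c Z = c.ι.app j :=
  restrictι_restrictDesc _ _ _ _

lemma restrictι_fromRestriction_assoc (Z : Set J) (j : J) (hj : j ∈ Z) {X : C} (g : c.pt ⟶ X) :
    restrictι F j hj ≫ fromRestriction c Z ≫ g = c.ι.app j ≫ g := by
  rw [← restrictι_fromRestriction c Z j hj, Category.assoc]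

@[simp]
lemma restrictionMap_fromRestriction {Z Z' : Set J} (h : Z ⊆ Z') :
    restrictionMap F h ≫ fromRestriction c Z' = fromRestriction c Z :=
  restrictColimit_hom_ext fun j hj ↦ by rw [restrictι_restrictionMap_assoc]; simp

/-- The diagram of colimits of restrictions to the members of a family of subsets. -/
@[simps]
noncomputable def restrictionDiagram (F : J ⥤ C) (p : Set J → Prop) : { Z // p Z } ⥤ C where
  obj Z := restrictColimit F Z.1
  map f := restrictionMap F (leOfHom f)
  map_id Z := restrictColimit_hom_ext fun j hj ↦ by simp
  map_comp f g := restrictColimit_hom_ext fun j hj ↦ by simp [restrictι_restrictionMap_assoc]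

/-- The comparison maps form a cocone. -/
@[simps!]
noncomputable def restrictionCocone (p : Set J → Prop) : Cocone (restrictionDiagram F p) :=
  coconeOfLE _ c.pt (fun Z ↦ fromRestriction c Z.1)
    fun _ _ _ ↦ restrictionMap_fromRestriction c _

/-- A colimit over a poset is the directed colimit of the colimits over the members of a
directed cover of the poset. -/
noncomputable def isColimitRestrictionCocone (hc : IsColimit c) (p : Set J → Prop)
    [IsDirectedOrder { Z // p Z }] (hp : ∀ j, ∃ Z, p Z ∧ j ∈ Z) :
    IsColimit (restrictionCocone c p) := by
  choose Z hpZ hZ using hp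
  let τ (s : Cocone (restrictionDiagram F p)) (W : { Z // p Z }) :
    restrictColimit F W.1 ⟶ s.pt := s.ι.app W
  have hτ (s : Cocone (restrictionDiagram F p)) (W W' : { Z // p Z }) (h : W ≤ W') :
    restrictionMap F h ≫ τ s W' = τ s W := s.w (homOfLE h)
  -- By directedness, the leg at `j` does not depend on which member of the cover containing `j` is
  -- used.
  have key (s : Cocone (restrictionDiagram F p)) (j : J) (W W' : { Z // p Z })
      (h : j ∈ W.1) (h' : j ∈ W'.1) :
      restrictι F j h ≫ τ s W = restrictι F j h' ≫ τ s W' := by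
    obtain ⟨V, hV, hV'⟩ := exists_ge_ge W W'
    rw [← hτ s _ _ hV, ← hτ s _ _ hV', restrictι_restrictionMap_assoc,
      restrictι_restrictionMap_assoc]
  let d (s : Cocone (restrictionDiagram F p)) : Cocone F :=
    coconeOfLE F s.pt (fun j ↦ restrictι F j (hZ j) ≫ τ s ⟨Z j, hpZ j⟩) fun j j' f ↦ by
      obtain ⟨V, hV, hV'⟩ := exists_ge_ge (⟨Z j, hpZ j⟩ : { Z // p Z }) ⟨Z j', hpZ j'⟩
      have h₁ := key s j ⟨Z j, hpZ j⟩ V (hZ j) (hV (hZ j))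
      have h₂ := key s j' ⟨Z j', hpZ j'⟩ V (hZ j') (hV' (hZ j'))
      rw [h₁, h₂, map_restrictι_assoc]
  exact
    { desc s := hc.desc (d s)
      fac s W := restrictColimit_hom_ext fun j hj ↦
        (restrictι_fromRestriction_assoc c W.1 j hj _).trans
          ((hc.fac (d s) j).trans (key s j ⟨Z j, hpZ j⟩ W (hZ j) hj))
      uniq s m hm := hc.hom_ext fun j ↦
        (restrictι_fromRestriction_assoc c (Z j) j (hZ j) m).symm.trans
          ((restrictι F j (hZ j) ≫= hm ⟨Z j, hpZ j⟩).trans (hc.fac (d s) j).symm) }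

end Restriction

/-! ### Pure maps and the Löwenheim–Skolem decomposition -/

section Pure

attribute [local instance] Cardinal.fact_isRegular_aleph0

/-- In a locally finitely presentable category, pure morphisms are monomorphisms. -/
lemma IsPure.mono {C : Type u} [Category.{w} C] [IsLocallyFinitelyPresentable.{w} C]
    {A B : C} {f : A ⟶ B} (hf : IsPure f) : Mono f := by
  obtain ⟨Q, _, hQ⟩ := HasCardinalFilteredGenerator.exists_small_generator C Cardinal.aleph0.{w}
  constructor
  intro W p q hpq
  refine hQ.isStrongGenerator.1 _ _ fun G hG e ↦ ?_
  have : IsFinitelyPresentable.{w} G := hQ.le_isCardinalPresentable _ hG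
  obtain ⟨J, _, _, ⟨pA⟩⟩ := hQ.exists_colimitsOfShape A
  have : IsFiltered J := isFiltered_of_isCardinalFiltered J Cardinal.aleph0
  obtain ⟨j, p', q', hp, hq⟩ : ∃ (j : J) (p' q' : G ⟶ pA.diag.obj j),
      p' ≫ pA.ι.app j = e ≫ p ∧ q' ≫ pA.ι.app j = e ≫ q := by
    obtain ⟨j₁, p', hp⟩ := IsFinitelyPresentable.exists_hom_of_isColimit pA.isColimit (e ≫ p)
    obtain ⟨j₂, q', hq⟩ := IsFinitelyPresentable.exists_hom_of_isColimit pA.isColimit (e ≫ q)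
    refine ⟨IsFiltered.max j₁ j₂, p' ≫ pA.diag.map (IsFiltered.leftToMax _ _),
      q' ≫ pA.diag.map (IsFiltered.rightToMax _ _), ?_, ?_⟩
    · simpa [ColimitPresentation.w] using hp
    · simpa [ColimitPresentation.w] using hq
  have hj : IsFinitelyPresentable.{w} (pA.diag.obj j) :=
    hQ.le_isCardinalPresentable _ (pA.prop_diag_obj j)
  have hE : IsFinitelyPresentable.{w} (coequalizer p' q') := by
    have (k : WalkingParallelPair) :
        IsCardinalPresentable ((parallelPair p' q').obj k) Cardinal.aleph0.{w} := by
      cases k <;> assumption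
    refine isCardinalPresentable_of_isColimit _ (colimit.isColimit (parallelPair p' q'))
      Cardinal.aleph0.{w} ?_
    rw [hasCardinalLT_aleph0_iff]
    infer_instance
  have w : p' ≫ pA.ι.app j ≫ f = q' ≫ pA.ι.app j ≫ f := by
    have := e ≫= hpq
    rw [← Category.assoc, ← Category.assoc, ← hp, ← hq] at this
    simpa using this
  -- Purity makes the coprojection at `j` factor through the coequalizer, so `p'` and `q'` already
  -- agree in `A`.
  obtain ⟨d, hd⟩ := hf hj hE (coequalizer.π p' q') (pA.ι.app j) (coequalizer.desc _ w) (by simp)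
  rw [← hp, ← hq, ← hd, coequalizer.condition_assoc]

variable {C : Type u} [Category.{w} C] {J : Type w} [PartialOrder J]

lemma IsFinitelyPresentable.exists_eq_map_of_isColimit [IsDirectedOrder J] [Nonempty J]
    {F : J ⥤ C} {c : Cocone F} (hc : IsColimit c) {A : C} (hA : IsFinitelyPresentable.{w} A)
    {i j : J} (f : A ⟶ F.obj i) (g : A ⟶ F.obj j) (h : f ≫ c.ι.app i = g ≫ c.ι.app j) :
    ∃ (k : J) (hi : i ≤ k) (hj : j ≤ k), f ≫ F.map (homOfLE hi) = g ≫ F.map (homOfLE hj) := by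
  obtain ⟨k, u, v, e⟩ := IsFinitelyPresentable.exists_eq_of_isColimit hc f g h
  exact ⟨k, leOfHom u, leOfHom v, e⟩

/-- A subset `Z` of a directed poset is *pure* with respect to a cocone `c` over a diagram if
factorizations through `c` of maps to the diagram over `Z` are realized inside `Z`. -/
structure IsPureSubset {F : J ⥤ C} (c : Cocone F) (Q : ObjectProperty C) (Z : Set J) : Prop where
  nonempty : Z.Nonempty
  directed : ∀ i ∈ Z, ∀ j ∈ Z, ∃ k ∈ Z, i ≤ k ∧ j ≤ k
  exists_factor : ∀ j ∈ Z, ∀ ⦃A B : C⦄, Q A → Q B → ∀ (g : A ⟶ B) (u : A ⟶ F.obj j)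
    (t : B ⟶ c.pt), u ≫ c.ι.app j = g ≫ t →
      ∃ k ∈ Z, ∃ (h : j ≤ k) (s : B ⟶ F.obj k), u ≫ F.map (homOfLE h) = g ≫ s

/-- The top of a test square descends to a stage in `Z`, since its domain is finitely presentable
and `Z` is directed. Testing on representatives from `Q` is enough, which is what allows `Q` to be
small. -/
lemma IsPureSubset.isPure_fromRestriction [HasColimitsOfSize.{w, w} C] {F : J ⥤ C} {c : Cocone F}
    {Q : ObjectProperty C} (hQ : ∀ A, IsFinitelyPresentable.{w} A → Q.isoClosure A)
    {Z : Set J} (hZ : IsPureSubset c Q Z) : IsPure (fromRestriction c Z) := by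
  intro A B hA hB g u t h
  obtain ⟨A', hA', ⟨eA⟩⟩ := hQ A hA
  obtain ⟨B', hB', ⟨eB⟩⟩ := hQ B hB
  have : Nonempty Z := hZ.nonempty.to_subtype
  have : IsDirectedOrder Z := ⟨fun i j ↦ by
    obtain ⟨k, hk, hik, hjk⟩ := hZ.directed i.1 i.2 j.1 j.2
    exact ⟨⟨k, hk⟩, hik, hjk⟩⟩
  obtain ⟨j, u', hu'⟩ : ∃ (j : Z) (u' : A ⟶ F.obj j.1), u' ≫ restrictι F j.1 j.2 = u :=
    IsFinitelyPresentable.exists_hom_of_isColimit (colimit.isColimit (restrictDiagram F Z)) u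
  obtain ⟨k, hk, hjk, s, hs⟩ := hZ.exists_factor j.1 j.2 hA' hB' (eA.inv ≫ g ≫ eB.hom)
    (eA.inv ≫ u') (eB.inv ≫ t) (by
      have : u' ≫ c.ι.app j.1 = g ≫ t := by
        rw [← h, ← hu', Category.assoc, restrictι_fromRestriction]
      simp [this])
  refine ⟨eB.hom ≫ s ≫ restrictι F k hk, ?_⟩
  simp only [Category.assoc, Iso.cancel_iso_inv_left] at hs
  rw [← hu', ← map_restrictι j.2 hk (homOfLE hjk), ← Category.assoc u', hs]
  simp

/-- The pure subsets of a directed poset, with respect to a small class of finitely presentable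
objects, contain the subsets generated by a small family of binary operations. -/
lemma exists_op_isPureSubset [IsDirectedOrder J] [Nonempty J] {F : J ⥤ C} {c : Cocone F}
    (hc : IsColimit c) {Q : ObjectProperty C} (hQ : ∀ A, Q A → IsFinitelyPresentable.{w} A)
    (hF : ∀ j, Q (F.obj j)) {A : Type w}
    (e : (Σ X : Subtype Q × Subtype Q × Subtype Q,
      (X.1.1 ⟶ X.2.1.1) × (X.1.1 ⟶ X.2.2.1)) → A) (he : Function.Injective e) :
    ∃ op : Option A → J → J → J, ∀ s, IsPureSubset c Q (generated op s) := by
  -- The code `a` records the object `F.obj j` but not the index `j`, so the set of codes is bounded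
  -- independently of `J`. The operation `none` gives upper bounds; `some a` solves the
  -- factorization problem coded by `a` at its first argument, when it is solvable.
  let good (a : A) (j k : J) : Prop :=
    ∃ (X Y : Subtype Q) (g : X.1 ⟶ Y.1) (u : X.1 ⟶ F.obj j) (h : j ≤ k) (s : Y.1 ⟶ F.obj k),
      a = e ⟨⟨X, Y, ⟨F.obj j, hF j⟩⟩, g, u⟩ ∧ u ≫ F.map (homOfLE h) = g ≫ s
  have hop (a : Option A) (i j : J) : ∃ k, (a = none → i ≤ k ∧ j ≤ k) ∧
      ∀ a', a = some a' → (∃ k', good a' i k') → good a' i k := by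
    cases a with
    | none => simpa using exists_ge_ge i j
    | some a =>
      by_cases h : ∃ k', good a i k'
      · exact ⟨h.choose, by simp, by rintro _ ⟨rfl⟩ _; exact h.choose_spec⟩
      · exact ⟨i, by simp, by rintro _ ⟨rfl⟩ h'; exact (h h').elim⟩
  choose op hop₁ hop₂ using hop
  refine ⟨op, fun s ↦ ⟨⟨_, mem_generated op s 0⟩, fun i hi j hj ↦
    ⟨_, op_mem_generated op s none hi hj, hop₁ none i j rfl⟩, ?_⟩⟩
  intro j hj X Y hX hY g u t h
  let a := e ⟨⟨⟨X, hX⟩, ⟨Y, hY⟩, ⟨F.obj j, hF j⟩⟩, g, u⟩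
  have ha : ∃ k, good a j k := by
    obtain ⟨k, s, rfl⟩ : ∃ (k : J) (s : Y ⟶ F.obj k), s ≫ c.ι.app k = t :=
      haveI := hQ Y hY
      IsFinitelyPresentable.exists_hom_of_isColimit hc t
    obtain ⟨l, hjl, hkl, e⟩ := IsFinitelyPresentable.exists_eq_map_of_isColimit hc (hQ X hX)
      u (g ≫ s) (by simpa using h)
    exact ⟨l, ⟨X, hX⟩, ⟨Y, hY⟩, g, u, hjl, s ≫ F.map (homOfLE hkl), rfl, by simpa using e⟩
  obtain ⟨X', Y', g', u', hk, s', hs, hs'⟩ := hop₂ (some a) j j a rfl ha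
  obtain ⟨h₁, h₂⟩ := Sigma.mk.inj (he hs)
  obtain rfl : (⟨X, hX⟩ : Subtype Q) = X' := congrArg (·.1) h₁
  obtain rfl : (⟨Y, hY⟩ : Subtype Q) = Y' := congrArg (·.2.1) h₁
  obtain ⟨rfl, rfl⟩ := Prod.mk.inj (eq_of_heq h₂)
  exact ⟨_, op_mem_generated op s (some a) hj hj, hk, s', hs'⟩

/-- Pulling the order back along `f` replaces `Z` by an equivalent preorder on the fixed set `T`.
Diagrams in a small `Q` over preorders on one set have, up to isomorphism, only a small class of
colimits. -/
lemma restrictColimit_mem_isoClosure [HasColimitsOfSize.{w, w} C] {F : J ⥤ C}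
    {Q : ObjectProperty C} (hF : ∀ j, Q (F.obj j)) {T : Type w} (Z : Set J) (f : T → J)
    (hf : Z = Set.range f) :
    (⨆ _ : Preorder T, Q.strictColimitsOfShape T).isoClosure (restrictColimit F Z) := by
  let _ : Preorder T := Preorder.lift f
  let f' : T → Z := fun t ↦ ⟨f t, hf ▸ ⟨t, rfl⟩⟩
  have hf' : Monotone f' := fun _ _ h ↦ h
  have : hf'.functor.EssSurj := ⟨fun j ↦ by
    obtain ⟨t, ht⟩ : j.1 ∈ Set.range f := hf ▸ j.2
    exact ⟨t, ⟨eqToIso (Subtype.ext ht)⟩⟩⟩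
  have : hf'.functor.Full := ⟨fun g ↦ ⟨homOfLE (leOfHom g), Subsingleton.elim _ _⟩⟩
  have : hf'.functor.Faithful := ⟨fun _ ↦ Subsingleton.elim _ _⟩
  have : hf'.functor.IsEquivalence := {}
  refine ⟨colimit (hf'.functor ⋙ restrictDiagram F Z), ?_,
    ⟨(Functor.Final.colimitIso hf'.functor (restrictDiagram F Z)).symm⟩⟩
  rw [iSup_apply, iSup_Prop_eq]
  exact ⟨_, .colimit _ fun j ↦ hF _⟩

/-- There is an essentially small class of objects of which every object of a locally finitely
presentable category is a directed colimit along pure morphisms. -/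
theorem exists_directed_colimit_isPure (C : Type u) [Category.{w} C]
    [IsLocallyFinitelyPresentable.{w} C] :
    ∃ R : ObjectProperty C, ObjectProperty.EssentiallySmall.{w} R ∧
      ∀ L : C, ∃ (I : Type w) (_ : PartialOrder I) (_ : IsDirectedOrder I) (_ : Nonempty I)
        (G : I ⥤ C) (c : Cocone G) (_ : IsColimit c) (_ : c.pt = L),
        ∀ i, R (G.obj i) ∧ IsPure (c.ι.app i) := by
  obtain ⟨Q₀, _, hQ₀⟩ :=
    HasCardinalFilteredGenerator.exists_small_generator C Cardinal.aleph0.{w}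
  obtain ⟨Q, _, hQ, hQ'⟩ := ObjectProperty.EssentiallySmall.exists_small_le.{w}
    (isCardinalPresentable C Cardinal.aleph0.{w})
  have hgen := hQ₀.of_le_isoClosure (hQ₀.le_isCardinalPresentable.trans hQ') hQ
  let A := Shrink.{w} (Σ X : Subtype Q × Subtype Q × Subtype Q,
    (X.1.1 ⟶ X.2.1.1) × (X.1.1 ⟶ X.2.2.1))
  let T := Tree.{w} (Option A)
  refine ⟨(⨆ _ : Preorder T, Q.strictColimitsOfShape T).isoClosure, ?_, fun L ↦ ?_⟩
  · infer_instance
  obtain ⟨J₀, _, _, hL⟩ := hgen.exists_colimitsOfShape L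
  have : IsFiltered J₀ := isFiltered_of_isCardinalFiltered J₀ Cardinal.aleph0
  obtain ⟨J, _, _, _, f, _⟩ := IsFiltered.exists_directed J₀
  obtain ⟨p⟩ := Q.colimitsOfShape_le_of_final f _ hL
  obtain ⟨op, hop⟩ := exists_op_isPureSubset p.isColimit hQ p.prop_diag_obj
    (equivShrink _ : _ → A) (equivShrink _).injective
  refine ⟨GeneratedSubset op, inferInstance, inferInstance,
    ⟨_, fun _ ↦ Classical.arbitrary J, rfl⟩, _, _,
    isColimitRestrictionCocone _ p.isColimit _ fun j ↦ ?_, rfl, fun i ↦ ⟨?_, ?_⟩⟩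
  · exact ⟨_, ⟨fun _ ↦ j, rfl⟩, mem_generated op (fun _ ↦ j) 0⟩
  · obtain ⟨_, s, rfl⟩ := i
    exact restrictColimit_mem_isoClosure p.prop_diag_obj _ _ rfl
  · obtain ⟨_, s, rfl⟩ := i
    exact (hop s).isPure_fromRestriction hQ'

end Pure

/-! ### Existence of products -/

section Complete

variable {D : Type u} [Category.{w} D]

/-- If every object of a complete category is a small limit of objects from a small class, then
colimits exist. -/
lemma hasColimitsOfShape_of_limitsOfShape [HasLimits D] (Q : ObjectProperty D)
    [ObjectProperty.Small.{w} Q]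
    (hQ : ∀ X, ∃ (K : Type w) (_ : SmallCategory K), Q.limitsOfShape K X)
    (J : Type w) [SmallCategory J] : HasColimitsOfShape J D := by
  rw [hasColimitsOfShape_iff_isRightAdjoint_const]
  refine isRightAdjoint_of_preservesLimits_of_solutionSetCondition _ fun A ↦ ?_
  let R : ObjectProperty (Cocone A) := fun s ↦ Q s.pt
  have : ObjectProperty.Small.{w} R := small_of_surjective
    (f := fun x : (Σ X : Subtype Q, A ⟶ (Functor.const J).obj X.1) ↦
      (⟨⟨x.1.1, x.2⟩, x.1.2⟩ : Subtype R)) fun ⟨s, hs⟩ ↦ ⟨⟨⟨s.pt, hs⟩, s.ι⟩, rfl⟩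
  have : EssentiallySmall.{w} R.FullSubcategory := essentiallySmall_of_small_of_locallySmall _
  have : HasLimitsOfShape R.FullSubcategory D :=
    hasLimitsOfShape_of_essentiallySmall.{w, w} R.FullSubcategory D
  let U : R.FullSubcategory ⥤ D := R.ι ⋙ Cocone.forget A
  let a (j : J) : A.obj j ⟶ limit U :=
    limit.lift U
      { pt := A.obj j
        π :=
          { app s := s.obj.ι.app j
            naturality s t f := (Category.id_comp _).trans (f.hom.w j).symm } }
  have ha (j : J) (s : R.FullSubcategory) : a j ≫ limit.π U s = s.obj.ι.app j :=
    limit.lift_π _ _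
  let α : A ⟶ (Functor.const J).obj (limit U) :=
    { app := a
      naturality j k f := by
        refine Eq.trans (limit.hom_ext fun s ↦ ?_) (Category.comp_id _).symm
        rw [Category.assoc, ha, ha]
        exact s.obj.w f }
  -- The limit of all cocones with point in `Q` alone forms a solution set: a cocone on a limit of
  -- objects of `Q` is determined by its components, each of which is one of the cocones in `U`.
  refine ⟨PUnit, fun _ ↦ limit U, fun _ ↦ α, fun X h ↦ ⟨⟨⟩, ?_⟩⟩
  obtain ⟨K, _, ⟨p⟩⟩ := hQ X
  let s (k : K) : R.FullSubcategory :=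
    ⟨⟨p.diag.obj k, h ≫ (Functor.const J).map (p.π.app k)⟩, p.prop_diag_obj k⟩
  let g : limit U ⟶ X := p.isLimit.lift
    { pt := limit U
      π :=
        { app k := limit.π U (s k)
          naturality k l f := by
            let e : s k ⟶ s l := ObjectProperty.homMk
              { hom := p.diag.map f
                w j := by
                  have : p.π.app k ≫ p.diag.map f = p.π.app l := (Cone.mk _ p.π).w f
                  simp [s, this] }
            exact (Category.id_comp _).trans (limit.w U e).symm } }
  refine ⟨g, NatTrans.ext (funext fun j ↦ p.isLimit.hom_ext fun k ↦ ?_)⟩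
  have hg : g ≫ p.π.app k = limit.π U (s k) := p.isLimit.fac _ k
  exact (Category.assoc (a j) g (p.π.app k)).trans ((a j ≫= hg).trans (ha j (s k)))

/-- A locally finitely presentable category has products. -/
lemma hasProducts_of_isLocallyFinitelyPresentable (C : Type u) [Category.{w} C]
    [IsLocallyFinitelyPresentable.{w} C] : HasProducts.{w} C := by
  have := Cardinal.fact_isRegular_aleph0.{w}
  obtain ⟨Q, _, hQ⟩ := HasCardinalFilteredGenerator.exists_small_generator C Cardinal.aleph0.{w}
  have : HasLimits Cᵒᵖ := inferInstance
  have (J : Type w) [SmallCategory J] : HasColimitsOfShape J Cᵒᵖ :=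
    hasColimitsOfShape_of_limitsOfShape Q.op (fun X ↦ by
      obtain ⟨K, _, _, hK⟩ := hQ.exists_colimitsOfShape X.unop
      rw [ObjectProperty.colimitsOfShape_eq_unop_limitsOfShape] at hK
      exact ⟨_, _, hK⟩) J
  have (J : Type w) : HasCoproductsOfShape J Cᵒᵖ := this (Discrete J)
  intro I
  exact hasProductsOfShape_of_opposite I

end Complete

/-! ### Elements of `X` at products -/

section Products

variable {D : Type u} [Category.{v} D] [HasProducts.{w} D] (X : D ⥤ Type w)
  [∀ I : Type w, PreservesLimitsOfShape (Discrete I) X]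

lemma existsUnique_map_π {I : Type w} (L : I → D) (y : ∀ i, X.obj (L i)) :
    ∃! z : X.obj (∏ᶜ L), ∀ i, X.map (Pi.π L i) z = y i := by
  have := (Types.isLimit_iff _).1
    ⟨isLimitOfPreserves X (limit.isLimit (Discrete.functor L))⟩ (fun i ↦ y i.as) (by
      rintro ⟨i⟩ ⟨j⟩ ⟨⟨⟨⟩⟩⟩
      exact (Discrete.functor L ⋙ X).map_id_apply _ _)
  obtain ⟨z, hz, hz'⟩ := this
  exact ⟨z, fun i ↦ hz ⟨i⟩, fun z' h ↦ hz' z' fun i ↦ h i.as⟩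

/-- The element of the value of `X` at a product with given components. -/
noncomputable def tuple {I : Type w} (L : I → D) (y : ∀ i, X.obj (L i)) : X.obj (∏ᶜ L) :=
  (existsUnique_map_π X L y).choose

@[simp]
lemma map_π_tuple {I : Type w} (L : I → D) (y : ∀ i, X.obj (L i)) (i : I) :
    X.map (Pi.π L i) (tuple X L y) = y i :=
  (existsUnique_map_π X L y).choose_spec.1 i

variable {X} in
lemma product_ext {I : Type w} {L : I → D} {z z' : X.obj (∏ᶜ L)}
    (h : ∀ i, X.map (Pi.π L i) z = X.map (Pi.π L i) z') : z = z' :=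
  (existsUnique_map_π X L fun i ↦ X.map (Pi.π L i) z').unique h fun _ ↦ rfl

end Products

/-! ### Weakly initial elements and weak reflections -/

section Definable

variable {C : Type u} [Category.{w} C] [IsLocallyFinitelyPresentable.{w} C]
  {P : ObjectProperty C}

/-- Closure under pure subobjects keeps the whole pure decomposition of `L` inside `P`, and
smallness of the class of pieces lets one set `S` serve every `L`. -/
lemma IsDefinableSubcategory.exists_directed_colimit (hP : IsDefinableSubcategory P) :
    ∃ (S : Type w) (N : S → P.FullSubcategory), ∀ L : P.FullSubcategory,
      ∃ (I : Type w) (_ : PartialOrder I) (_ : IsDirectedOrder I) (_ : Nonempty I)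
        (G : I ⥤ P.FullSubcategory) (c : Cocone G) (_ : IsColimit c)
        (_ : IsColimit (P.ι.mapCocone c)) (_ : c.pt = L),
        ∀ i, ∃ a, Nonempty (N a ≅ G.obj i) := by
  obtain ⟨R, hR, hR'⟩ := exists_directed_colimit_isPure.{w} C
  obtain ⟨Q, _, hQ, hQ'⟩ :
      ∃ (Q : ObjectProperty C) (_ : ObjectProperty.Small.{w} Q), Q ≤ P ∧ R ⊓ P ≤ Q.isoClosure := by
    have : ObjectProperty.EssentiallySmall.{w} (R ⊓ P) := .of_le (Q := R) inf_le_left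
    obtain ⟨Q, hQ₀, hQ, hQ'⟩ := ObjectProperty.EssentiallySmall.exists_small_le.{w} (R ⊓ P)
    exact ⟨Q, hQ₀, hQ.trans inf_le_right, hQ'⟩
  refine ⟨Shrink.{w} (Subtype Q), fun a ↦ ⟨((equivShrink _).symm a).1, hQ _ (Subtype.prop _)⟩, ?_⟩
  rintro ⟨L, hL⟩
  obtain ⟨I, _, _, _, G, c, hc, rfl, h⟩ := hR' L
  have hG (i : I) : P (G.obj i) := hP.pureSubobjects _ (h i).2.mono (h i).2 hL
  let c' : Cocone (P.lift G hG) :=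
    { pt := ⟨c.pt, hL⟩
      ι :=
        { app i := ObjectProperty.homMk (c.ι.app i)
          naturality i j f := ObjectProperty.hom_ext _ (c.ι.naturality f) } }
  have hc' : IsColimit (P.ι.mapCocone c') := hc
  refine ⟨I, _, inferInstance, inferInstance, P.lift G hG, c', isColimitOfReflects P.ι hc', hc',
    rfl, fun i ↦ ?_⟩
  obtain ⟨B, hB, ⟨e⟩⟩ := hQ' _ ⟨(h i).1, hG i⟩
  exact ⟨equivShrink _ ⟨B, hB⟩, ⟨P.isoMk (eqToIso (by simp) ≪≫ e.symm)⟩⟩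

variable (hP : IsDefinableSubcategory P)
include hP

lemma IsDefinableSubcategory.hasProducts : HasProducts.{w} P.FullSubcategory := fun I ↦
  have := hP.products I
  have := hasProducts_of_isLocallyFinitelyPresentable C I
  inferInstance

lemma IsDefinableSubcategory.preservesProducts_ι (I : Type w) :
    PreservesLimitsOfShape (Discrete I) P.ι :=
  have := hP.products I
  have := hasProducts_of_isLocallyFinitelyPresentable C I
  inferInstance

/-- Restricted representable functors at finitely presentable objects preserve products and
directed colimits. -/
lemma IsDefinableSubcategory.restrictedHom_products (A : C) (I : Type w) :
    PreservesLimitsOfShape (Discrete I) (restrictedHom P A) :=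
  have := hP.preservesProducts_ι I
  inferInstance

lemma IsDefinableSubcategory.preserves_restrictedHom {A : C} (hA : IsFinitelyPresentable.{w} A) :
    PreservesProductsAndDirectedColimits.{w} (restrictedHom P A) where
  products := hP.restrictedHom_products A
  directedColimits I _ _ _ :=
    have := hP.directedColimits I
    inferInstance

/-- A functor in `P⁺` has a weakly initial element. -/
lemma IsDefinableSubcategory.exists_weaklyInitial {X : P.FullSubcategory ⥤ Type w}
    (hX : PreservesProductsAndDirectedColimits.{w} X) :
    ∃ (M : P.FullSubcategory) (x : X.obj M), ∀ (L : P.FullSubcategory) (y : X.obj L),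
      ∃ h : M ⟶ L, X.map h x = y := by
  have := hP.hasProducts
  have := hX.products
  obtain ⟨S, N, hN⟩ := hP.exists_directed_colimit
  refine ⟨∏ᶜ fun b : Σ a, X.obj (N a) ↦ N b.1, tuple X _ fun b ↦ b.2, fun L y ↦ ?_⟩
  obtain ⟨I, _, _, _, G, c, hc, -, rfl, h⟩ := hN L
  have := hX.directedColimits I
  obtain ⟨i, z, rfl⟩ := Types.jointly_surjective_of_isColimit (isColimitOfPreserves X hc) y
  obtain ⟨a, ⟨e⟩⟩ := h i
  refine ⟨Pi.π (fun b : Σ a, X.obj (N a) ↦ N b.1) ⟨a, X.map e.inv z⟩ ≫ e.hom ≫ c.ι.app i, ?_⟩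
  have he : X.map e.hom (X.map e.inv z) = z := by
    rw [← Functor.map_comp_apply, e.inv_hom_id, Functor.map_id_apply]
  simp only [Functor.map_comp_apply, map_π_tuple, he]
  rfl

/-- Finitely presentable objects have weak reflections in a definable subcategory. -/
lemma IsDefinableSubcategory.exists_weakReflection {A : C} (hA : IsFinitelyPresentable.{w} A) :
    ∃ (N : P.FullSubcategory) (r : A ⟶ N.obj), ∀ (L : P.FullSubcategory) (f : A ⟶ L.obj),
      ∃ a : N ⟶ L, r ≫ a.hom = f := by
  obtain ⟨M, x, h⟩ := hP.exists_weaklyInitial (hP.preserves_restrictedHom hA)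
  exact ⟨M, x, h⟩

end Definable

/-! ### Reduced products modulo tails, and germs -/

section ReducedProduct

variable {D : Type u} [Category.{v} D] [HasProducts.{w} D] {J : Type w} [PartialOrder J]

/-- The diagram of products of a family over the up-closures of elements of a poset. -/
noncomputable def tailProducts (L : J → D) : J ⥤ D where
  obj i := ∏ᶜ fun k : Set.Ici i ↦ L k
  map {i j} f := Pi.lift fun k : Set.Ici j ↦
    Pi.π (fun k : Set.Ici i ↦ L k) ⟨k.1, (leOfHom f).trans k.2⟩
  map_id i := Limits.Pi.hom_ext _ _ fun k ↦ by simp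
  map_comp f g := Limits.Pi.hom_ext _ _ fun k ↦ by simp

/-- The natural transformation between diagrams of products induced by a family of morphisms. -/
noncomputable def tailProductsMap {L L' : J → D} (a : ∀ k, L k ⟶ L' k) :
    tailProducts L ⟶ tailProducts L' where
  app i := Limits.Pi.map fun k : Set.Ici i ↦ a k.1
  naturality i j f := Limits.Pi.hom_ext _ _ fun k ↦ by simp [tailProducts]

lemma tuple_restrict (X : D ⥤ Type w) [∀ I : Type w, PreservesLimitsOfShape (Discrete I) X]
    {L : J → D} {i j : J} (h : i ≤ j) (y : ∀ k, i ≤ k → X.obj (L k)) :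
    X.map (Pi.lift fun k : Set.Ici j ↦ Pi.π (fun k : Set.Ici i ↦ L k) ⟨k.1, h.trans k.2⟩)
      (tuple X _ fun k : Set.Ici i ↦ y k.1 k.2) =
        tuple X _ fun k : Set.Ici j ↦ y k.1 (h.trans k.2) :=
  product_ext fun k ↦ by
    rw [← Functor.map_comp_apply, Pi.lift_π, map_π_tuple, map_π_tuple]

variable [HasColimitsOfShape J D]

/-- The reduced product of a family indexed by a directed poset, with respect to the filter
of tails. -/
noncomputable def reducedProduct (L : J → D) : D := colimit (tailProducts L)

/-- The coprojections to the reduced product. -/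
noncomputable def reducedProductι (L : J → D) (i : J) :
    (∏ᶜ fun k : Set.Ici i ↦ L k) ⟶ reducedProduct L :=
  colimit.ι (tailProducts L) i

/-- The morphism between reduced products induced by a family of morphisms. -/
noncomputable def reducedProductMap {L L' : J → D} (a : ∀ k, L k ⟶ L' k) :
    reducedProduct L ⟶ reducedProduct L' :=
  colim.map (tailProductsMap a)

lemma reducedProductι_map {L L' : J → D} (a : ∀ k, L k ⟶ L' k) (i : J) :
    reducedProductι L i ≫ reducedProductMap a =
      (Limits.Pi.map fun k : Set.Ici i ↦ a k.1) ≫ reducedProductι L' i :=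
  colimit.ι_map _ _

lemma lift_reducedProductι (L : J → D) {i j : J} (h : i ≤ j) :
    (Pi.lift fun k : Set.Ici j ↦ Pi.π (fun k : Set.Ici i ↦ L k) ⟨k.1, h.trans k.2⟩) ≫
      reducedProductι L j = reducedProductι L i :=
  colimit.w (tailProducts L) (homOfLE h)

variable (X : D ⥤ Type w) [∀ I : Type w, PreservesLimitsOfShape (Discrete I) X]

/-- The element of the value of `X` at a reduced product represented by a family of elements
defined on a tail. -/
noncomputable def germ {L : J → D} (i : J) (y : ∀ k, i ≤ k → X.obj (L k)) :
    X.obj (reducedProduct L) :=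
  X.map (reducedProductι L i) (tuple X _ fun k : Set.Ici i ↦ y k.1 k.2)

lemma germ_restrict {L : J → D} {i j : J} (h : i ≤ j) (y : ∀ k, i ≤ k → X.obj (L k)) :
    germ X j (fun k hk ↦ y k (h.trans hk)) = germ X i y := by
  rw [germ, germ, ← lift_reducedProductι L h, Functor.map_comp_apply, tuple_restrict X h]

lemma germ_eq {L : J → D} {i i' j : J} (h : i ≤ j) (h' : i' ≤ j) (y : ∀ k, i ≤ k → X.obj (L k))
    (y' : ∀ k, i' ≤ k → X.obj (L k)) (hy : ∀ k (hk : j ≤ k), y k (h.trans hk) = y' k (h'.trans hk)) :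
    germ X i y = germ X i' y' := by
  rw [← germ_restrict X h, ← germ_restrict X h']
  exact congrArg (germ X j) (funext₂ hy)

lemma map_germ {L L' : J → D} (a : ∀ k, L k ⟶ L' k) (i : J) (y : ∀ k, i ≤ k → X.obj (L k)) :
    X.map (reducedProductMap a) (germ X i y) = germ X i fun k hk ↦ X.map (a k) (y k hk) := by
  rw [germ, germ, ← Functor.map_comp_apply, reducedProductι_map, Functor.map_comp_apply]
  congr 1
  refine product_ext fun k ↦ ?_
  rw [← Functor.map_comp_apply, Limits.Pi.map_π, Functor.map_comp_apply, map_π_tuple, map_π_tuple]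

lemma map_diagonal {M : D} (i : J) (x : X.obj M) :
    X.map ((Pi.lift fun _ : Set.Ici i ↦ 𝟙 M) ≫ reducedProductι (fun _ ↦ M) i) x =
      germ X i fun _ _ ↦ x := by
  rw [germ, Functor.map_comp_apply]
  congr 1
  refine product_ext fun k ↦ ?_
  rw [← Functor.map_comp_apply, Pi.lift_π, map_π_tuple, Functor.map_id_apply]

variable {X} in
lemma app_germ {X' : D ⥤ Type w} [∀ I : Type w, PreservesLimitsOfShape (Discrete I) X']
    (τ : X ⟶ X') {L : J → D} (i : J) (y : ∀ k, i ≤ k → X.obj (L k)) :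
    τ.app _ (germ X i y) = germ X' i fun k hk ↦ τ.app _ (y k hk) := by
  rw [germ, germ, NatTrans.naturality_apply]
  congr 1
  refine product_ext fun k ↦ ?_
  rw [← NatTrans.naturality_apply, map_π_tuple, map_π_tuple]

variable [PreservesColimitsOfShape J X]

/-- Since `X` preserves the directed colimit, `z` comes from a product over some tail, where it is
given by its components. -/
lemma exists_eq_germ {L : J → D} (z : X.obj (reducedProduct L)) :
    ∃ (i : J) (y : ∀ k, i ≤ k → X.obj (L k)), germ X i y = z := by
  obtain ⟨i, z, rfl⟩ := Types.jointly_surjective_of_isColimit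
    (isColimitOfPreserves X (colimit.isColimit (tailProducts L))) z
  refine ⟨i, fun k hk ↦ X.map (Pi.π (fun k : Set.Ici i ↦ L k) ⟨k, hk⟩) z, ?_⟩
  refine congrArg (X.map (reducedProductι L i)) (product_ext fun k ↦ ?_)
  rw [map_π_tuple]

lemma exists_eq_of_germ_eq [IsDirectedOrder J] [Nonempty J] {L : J → D} {i i' : J} (y : ∀ k, i ≤ k → X.obj (L k))
    (y' : ∀ k, i' ≤ k → X.obj (L k)) (h : germ X i y = germ X i' y') :
    ∃ (j : J) (h : i ≤ j) (h' : i' ≤ j), ∀ k (hk : j ≤ k),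
      y k (h.trans hk) = y' k (h'.trans hk) := by
  obtain ⟨j, f, g, e⟩ := (Types.FilteredColimit.isColimit_eq_iff _
    (isColimitOfPreserves X (colimit.isColimit (tailProducts L)))).1 h
  refine ⟨j, leOfHom f, leOfHom g, fun k hk ↦ ?_⟩
  have e' := (tuple_restrict X (leOfHom f) y).symm.trans (e.trans (tuple_restrict X (leOfHom g) y'))
  have := congrArg (X.map (Pi.π (fun k : Set.Ici j ↦ L k) ⟨k, hk⟩)) e'
  rwa [map_π_tuple, map_π_tuple] at this

end ReducedProduct

/-! ### The compactness argument -/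

section Compactness

variable {C : Type u} [Category.{w} C] {P : ObjectProperty C} {J : Type w} [PartialOrder J]
  {K : J ⥤ C} {M : P.FullSubcategory} {κ : K ⟶ (Functor.const J).obj M.obj}

lemma hom_ext_of_restrictedHom (hκ : IsColimit (Cocone.mk _ κ))
    {L : P.FullSubcategory} {f g : M ⟶ L}
    (h : ∀ m, (restrictedHom P (K.obj m)).map f (κ.app m) =
      (restrictedHom P (K.obj m)).map g (κ.app m)) : f = g :=
  ObjectProperty.hom_ext _ (hκ.hom_ext h)

variable [HasProducts.{w} P.FullSubcategory] [HasColimitsOfShape J P.FullSubcategory]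
  [∀ A, ∀ I : Type w, PreservesLimitsOfShape (Discrete I) (restrictedHom P A)]

/-- The morphism to a reduced product induced by a family of morphisms from the objects of a
diagram. -/
noncomputable def toReducedProduct (hκ : IsColimit (Cocone.mk _ κ))
    {L : J → P.FullSubcategory} (φ : ∀ k, K.obj k ⟶ (L k).obj) :
    M ⟶ reducedProduct L :=
  ObjectProperty.homMk (hκ.desc (coconeOfLE K _
    -- A map from `K.obj m` to the reduced product is an element of a restricted representable, so
    -- it can be given as a germ; this uses only preservation of products.
    (fun m ↦ germ (restrictedHom P (K.obj m)) m fun k hk ↦ K.map (homOfLE hk) ≫ φ k)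
    fun i j hij ↦ by
      refine (app_germ (Functor.whiskerLeft P.ι (coyoneda.map (K.map (homOfLE hij)).op)) _ _).trans
        (germ_eq _ le_rfl hij _ _ fun k hk ↦ ?_)
      exact (Category.assoc _ _ _).symm.trans (congrArg (· ≫ φ k) (K.map_comp (homOfLE hij) (homOfLE hk)).symm)))

lemma ι_toReducedProduct (hκ : IsColimit (Cocone.mk _ κ))
    {L : J → P.FullSubcategory} (φ : ∀ k, K.obj k ⟶ (L k).obj) (m : J) :
    (restrictedHom P (K.obj m)).map (toReducedProduct hκ φ) (κ.app m) =
      germ (restrictedHom P (K.obj m)) m fun k hk ↦ K.map (homOfLE hk) ≫ φ k :=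
  hκ.fac _ m

lemma toReducedProduct_map (hκ : IsColimit (Cocone.mk _ κ))
    {L L' : J → P.FullSubcategory} (φ : ∀ k, K.obj k ⟶ (L k).obj)
    (a : ∀ k, L k ⟶ L' k) :
    toReducedProduct hκ φ ≫ reducedProductMap a = toReducedProduct hκ fun k ↦ φ k ≫ (a k).hom :=
  hom_ext_of_restrictedHom hκ fun m ↦ by
    rw [Functor.map_comp_apply, ι_toReducedProduct, ι_toReducedProduct, map_germ]
    exact germ_eq _ le_rfl le_rfl _ _ fun k hk ↦ Category.assoc _ _ _

/-- By the cocone identity, the family `K m ⟶ K k ⟶ M` is constant in `k`, so its germ is diagonal;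
the tail `i` is immaterial. -/
lemma toReducedProduct_diagonal [IsDirectedOrder J] (hκ : IsColimit (Cocone.mk _ κ))
    (i : J) :
    toReducedProduct hκ (fun k ↦ κ.app k) =
      (Pi.lift fun _ : Set.Ici i ↦ 𝟙 M) ≫ reducedProductι (fun _ ↦ M) i :=
  hom_ext_of_restrictedHom hκ fun m ↦ by
    rw [ι_toReducedProduct, map_diagonal]
    obtain ⟨j, hj, hj'⟩ := exists_ge_ge m i
    exact germ_eq _ hj hj' _ _ fun k hk ↦ (Cocone.mk _ κ).w _

variable [IsDirectedOrder J] [Nonempty J] {X : P.FullSubcategory ⥤ Type w}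
  [∀ I : Type w, PreservesLimitsOfShape (Discrete I) X] [PreservesColimitsOfShape J X]

/-- Let `M` be the colimit of a directed diagram `K` and let `x` be an element of `X` at `M`.
Given weak reflections `r` of the objects of `K`, some `r k` carries an element `y` of `X` such
that `(r k, y)` determines a well-defined transformation, having `x` in its image. -/
lemma exists_element (hκ : IsColimit (Cocone.mk _ κ))
    (x : X.obj M) {N : J → P.FullSubcategory} (r : ∀ k, K.obj k ⟶ (N k).obj)
    (hr : ∀ k (L : P.FullSubcategory) (f : K.obj k ⟶ L.obj), ∃ a : N k ⟶ L, r k ≫ a.hom = f) :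
    ∃ (k : J) (y : X.obj (N k)),
      (∀ (L : P.FullSubcategory) (a b : N k ⟶ L), r k ≫ a.hom = r k ≫ b.hom →
        X.map a y = X.map b y) ∧
      ∃ a : N k ⟶ M, r k ≫ a.hom = κ.app k ∧ X.map a y = x := by
  obtain ⟨i, y, hy⟩ := exists_eq_germ X (X.map (toReducedProduct hκ r) x)
  have hmap {L : J → P.FullSubcategory} (a : ∀ k, N k ⟶ L k) :
      germ X i (fun k hk ↦ X.map (a k) (y k hk)) =
        X.map (toReducedProduct hκ fun k ↦ r k ≫ (a k).hom) x := by
    rw [← toReducedProduct_map, Functor.map_comp_apply, ← hy, map_germ]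
  -- At each `k` pick a pair violating well-definedness at `y k`, or a trivial pair if there is
  -- none. Agreement on the chosen pair then forces agreement on all pairs.
  have hchoice (k : J) : ∃ (L : P.FullSubcategory) (a b : N k ⟶ L), r k ≫ a.hom = r k ≫ b.hom ∧
      ∀ hk : i ≤ k, X.map a (y k hk) = X.map b (y k hk) →
        ∀ (L : P.FullSubcategory) (a b : N k ⟶ L), r k ≫ a.hom = r k ≫ b.hom →
          X.map a (y k hk) = X.map b (y k hk) := by
    by_cases H : ∃ hk : i ≤ k, ∃ (L : P.FullSubcategory) (a b : N k ⟶ L),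
      r k ≫ a.hom = r k ≫ b.hom ∧ X.map a (y k hk) ≠ X.map b (y k hk)
    · obtain ⟨hk, L, a, b, h, h'⟩ := H
      exact ⟨L, a, b, h, fun _ h'' ↦ (h' h'').elim⟩
    · push Not at H
      exact ⟨N k, 𝟙 _, 𝟙 _, rfl, fun hk _ ↦ H hk⟩
  choose L a b hab hab' using hchoice
  choose d hd using fun k ↦ hr k M (κ.app k)
  obtain ⟨j₁, h₁, _, H₁⟩ := exists_eq_of_germ_eq X _ _ ((hmap a).trans (by
    simp only [hab]; exact (hmap b).symm))
  obtain ⟨j₂, h₂, _, H₂⟩ := exists_eq_of_germ_eq X _ _ ((hmap d).trans (by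
    simp only [hd]; rw [toReducedProduct_diagonal hκ i, map_diagonal]))
  obtain ⟨j, hj₁, hj₂⟩ := exists_ge_ge j₁ j₂
  exact ⟨j, y j (h₁.trans hj₁), hab' j _ (H₁ j hj₁), d j, hd j, H₂ j hj₂⟩

end Compactness

/-! ### Kernel pairs and regular epimorphisms -/

section KernelPair

variable {D : Type u} [Category.{v} D] {F X : D ⥤ Type w} (η : F ⟶ X)

/-- The kernel pair of a natural transformation between set-valued functors. -/
def kernelPair : D ⥤ Type w where
  obj L := { p : F.obj L × F.obj L // η.app L p.1 = η.app L p.2 }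
  map f := ↾fun p ↦ ⟨(F.map f p.1.1, F.map f p.1.2), by
    rw [NatTrans.naturality_apply, NatTrans.naturality_apply, p.2]⟩
  map_id L := by
    ext p
    · exact F.map_id_apply _ p.1.1
    · exact F.map_id_apply _ p.1.2
  map_comp f g := by
    ext p
    · exact F.map_comp_apply f g p.1.1
    · exact F.map_comp_apply f g p.1.2

/-- The first projection of the kernel pair. -/
def kernelPairFst : kernelPair η ⟶ F where
  app L := ↾fun p ↦ p.1.1

/-- The second projection of the kernel pair. -/
def kernelPairSnd : kernelPair η ⟶ F where
  app L := ↾fun p ↦ p.1.2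

lemma kernelPair_condition : kernelPairFst η ≫ η = kernelPairSnd η ≫ η := by
  ext L p
  exact p.2

lemma preservesLimitsOfShape_kernelPair (J : Type w) [SmallCategory J]
    [PreservesLimitsOfShape J F] [PreservesLimitsOfShape J X] :
    PreservesLimitsOfShape J (kernelPair η) := by
  refine ⟨fun {G} ↦ ⟨fun {c} hc ↦ (Types.isLimit_iff _).2 fun s hs ↦ ?_⟩⟩
  have h₁ : (fun j ↦ (s j).1.1) ∈ (G ⋙ F).sections := fun f ↦
    congrArg (fun p ↦ p.1.1) (hs f)
  have h₂ : (fun j ↦ (s j).1.2) ∈ (G ⋙ F).sections := fun f ↦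
    congrArg (fun p ↦ p.1.2) (hs f)
  have h₃ : (fun j ↦ η.app _ (s j).1.1) ∈ (G ⋙ X).sections := fun {j k} f ↦ by
    have := h₁ f
    dsimp at this ⊢
    rw [← NatTrans.naturality_apply, this]
  have HF := (Types.isLimit_iff (F.mapCone c)).1 ⟨isLimitOfPreserves F hc⟩
  obtain ⟨x, hx, hx'⟩ := HF _ h₁
  obtain ⟨y, hy, hy'⟩ := HF _ h₂
  have hxy : η.app _ x = η.app _ y := by
    refine ((Types.isLimit_iff (X.mapCone c)).1 ⟨isLimitOfPreserves X hc⟩ _ h₃).unique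
      (fun j ↦ ?_) (fun j ↦ ?_)
    · exact (NatTrans.naturality_apply η (c.π.app j) x).symm.trans (congrArg _ (hx j))
    · exact (NatTrans.naturality_apply η (c.π.app j) y).symm.trans
        ((congrArg _ (hy j)).trans (s j).2.symm)
  refine ⟨⟨(x, y), hxy⟩, fun j ↦ Subtype.ext (Prod.ext (hx j) (hy j)), fun z hz ↦ ?_⟩
  exact Subtype.ext (Prod.ext (hx' _ fun j ↦ congrArg (fun p ↦ p.1.1) (hz j))
    (hy' _ fun j ↦ congrArg (fun p ↦ p.1.2) (hz j)))

/-- Kernel pairs are pointwise finite limits, which commute with directed colimits of sets. -/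
lemma preservesColimitsOfShape_kernelPair (J : Type w) [PartialOrder J] [IsDirectedOrder J]
    [Nonempty J] [PreservesColimitsOfShape J F] [PreservesColimitsOfShape J X] :
    PreservesColimitsOfShape J (kernelPair η) := by
  refine ⟨fun {G} ↦ ⟨fun {c} hc ↦ ⟨?_⟩⟩⟩
  have hF := isColimitOfPreserves F hc
  have hX := isColimitOfPreserves X hc
  refine Types.FilteredColimit.isColimitOf' _ _ ?_ ?_
  · rintro ⟨⟨x, y⟩, hxy⟩
    obtain ⟨i, x, y, rfl, rfl⟩ := Types.FilteredColimit.jointly_surjective_of_isColimit₂ hF x y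
    have h : X.map (c.ι.app i) (η.app _ x) = X.map (c.ι.app i) (η.app _ y) :=
      (NatTrans.naturality_apply η (c.ι.app i) x).symm.trans
        (Eq.trans hxy (NatTrans.naturality_apply η (c.ι.app i) y))
    obtain ⟨k, f, hf⟩ := (Types.FilteredColimit.isColimit_eq_iff' hX _ _).1 h
    refine ⟨k, ⟨(F.map (G.map f) x, F.map (G.map f) y), ?_⟩, Subtype.ext (Prod.ext ?_ ?_)⟩
    · rw [NatTrans.naturality_apply, NatTrans.naturality_apply]
      exact hf
    · exact ((F.map_comp_apply _ _ _).symm.trans (by rw [c.w]; rfl)).symm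
    · exact ((F.map_comp_apply _ _ _).symm.trans (by rw [c.w]; rfl)).symm
  · rintro i ⟨⟨x, y⟩, hxy⟩ ⟨⟨x', y'⟩, hxy'⟩ h
    obtain ⟨j, f, hf⟩ := (Types.FilteredColimit.isColimit_eq_iff' hF x x').1
      (congrArg (fun p ↦ p.1.1) h)
    obtain ⟨k, g, hg⟩ := (Types.FilteredColimit.isColimit_eq_iff' hF y y').1
      (congrArg (fun p ↦ p.1.2) h)
    obtain ⟨l, hj, hk⟩ := exists_ge_ge j k
    have key {m : J} (f : i ⟶ m) (hm : m ≤ l) (a b : (G ⋙ F).obj i)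
        (e : (G ⋙ F).map f a = (G ⋙ F).map f b) (t : i ⟶ l) :
        (G ⋙ F).map t a = (G ⋙ F).map t b := by
      obtain rfl : t = f ≫ homOfLE hm := Subsingleton.elim _ _
      rw [Functor.map_comp_apply, e, Functor.map_comp_apply]
    exact ⟨l, homOfLE ((leOfHom f).trans hj), Subtype.ext (Prod.ext
      (key f hj _ _ hf _) (key g hk _ _ hg _))⟩

lemma preserves_kernelPair (hF : PreservesProductsAndDirectedColimits.{w} F)
    (hX : PreservesProductsAndDirectedColimits.{w} X) :
    PreservesProductsAndDirectedColimits.{w} (kernelPair η) where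
  products I :=
    have := hF.products I
    have := hX.products I
    preservesLimitsOfShape_kernelPair η _
  directedColimits I _ _ _ :=
    have := hF.directedColimits I
    have := hX.directedColimits I
    preservesColimitsOfShape_kernelPair η I

/-- A pointwise surjective natural transformation is a regular epimorphism in `D⁺`. -/
lemma isRegularEpi_of_surjective {F X : Plus.{w} D} (η : F ⟶ X)
    (hη : ∀ L, Function.Surjective (η.hom.app L)) : IsRegularEpi η := by
  let W : Plus.{w} D := ⟨kernelPair η.hom, preserves_kernelPair η.hom F.property X.property⟩
  let p : W ⟶ F := ObjectProperty.homMk (kernelPairFst η.hom)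
  let q : W ⟶ F := ObjectProperty.homMk (kernelPairSnd η.hom)
  have hpq : p ≫ η = q ≫ η := ObjectProperty.hom_ext _ (kernelPair_condition η.hom)
  -- The section `σ` need not be natural; `s.π` identifies elements with the same image under `η`,
  -- which makes the induced `d` natural.
  choose σ hσ using hη
  refine ⟨⟨⟨W, p, q, hpq, Cofork.IsColimit.mk' _ fun s ↦ ?_⟩⟩⟩
  have hs (L : D) (x y : F.obj.obj L) (h : η.hom.app L x = η.hom.app L y) :
      s.π.hom.app L x = s.π.hom.app L y := by
    have e : p ≫ s.π = q ≫ s.π := s.condition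
    exact congrArg (fun f : W ⟶ s.pt ↦ f.hom.app L ⟨(x, y), h⟩) e
  let d : X ⟶ s.pt := ObjectProperty.homMk
    { app L := ↾fun x ↦ s.π.hom.app L (σ L x)
      naturality L L' f := by
        ext x
        refine Eq.trans (hs L' _ (F.obj.map f (σ L x)) ?_)
          (NatTrans.naturality_apply s.π.hom f (σ L x))
        rw [hσ, NatTrans.naturality_apply, hσ]
        rfl }
  refine ⟨d, ?_, fun {m} hm ↦ ?_⟩
  · refine ObjectProperty.hom_ext _ ?_
    ext L x
    exact hs L _ _ (hσ L _)
  · refine ObjectProperty.hom_ext _ ?_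
    ext L x
    have : m.hom.app L (η.hom.app L (σ L x)) = s.π.hom.app L (σ L x) :=
      congrArg (fun f : F ⟶ s.pt ↦ f.hom.app L (σ L x)) hm
    rw [hσ] at this
    exact this

end KernelPair

/-! ### The surjection from a restricted representable -/

section Definable

variable {C : Type u} [Category.{w} C] [IsLocallyFinitelyPresentable.{w} C]
  {P : ObjectProperty C}

/-- Every functor in `P⁺` is a pointwise quotient of a restricted representable functor at a
finitely presentable object. -/
theorem IsDefinableSubcategory.exists_surjective (hP : IsDefinableSubcategory P)
    {X : P.FullSubcategory ⥤ Type w} (hX : PreservesProductsAndDirectedColimits.{w} X) :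
    ∃ (A : C) (_ : IsFinitelyPresentable.{w} A) (η : restrictedHom P A ⟶ X),
      ∀ L, Function.Surjective (η.app L) := by
  have := Cardinal.fact_isRegular_aleph0.{w}
  obtain ⟨M, x, hx⟩ := hP.exists_weaklyInitial hX
  obtain ⟨Q, _, hQ⟩ := HasCardinalFilteredGenerator.exists_small_generator C Cardinal.aleph0.{w}
  obtain ⟨J₀, _, _, hM⟩ := hQ.exists_colimitsOfShape M.obj
  have : IsFiltered J₀ := isFiltered_of_isCardinalFiltered J₀ Cardinal.aleph0
  obtain ⟨J, _, _, _, f, _⟩ := IsFiltered.exists_directed J₀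
  obtain ⟨p⟩ := Q.colimitsOfShape_le_of_final f _ hM
  have hK (k : J) : IsFinitelyPresentable.{w} (p.diag.obj k) :=
    hQ.le_isCardinalPresentable _ (p.prop_diag_obj k)
  choose N r hr using fun k ↦ hP.exists_weakReflection (hK k)
  have := hP.hasProducts
  have := hP.directedColimits J
  have := hP.restrictedHom_products
  have := hX.products
  have := hX.directedColimits J
  obtain ⟨k, y, hy, d, hd, hdx⟩ := exists_element p.isColimit x r hr
  choose a ha using hr k
  refine ⟨p.diag.obj k, hK k,
    { app L := ↾fun f ↦ X.map (a L f) y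
      naturality L L' g := ?_ }, fun L z ↦ ?_⟩
  · ext f
    refine Eq.trans ?_ (X.map_comp_apply _ _ _)
    refine hy _ _ _ ?_
    rw [ha, ObjectProperty.FullSubcategory.comp_hom, ← Category.assoc, ha]
    rfl
  · obtain ⟨h, rfl⟩ := hx L z
    -- The coprojection at `k` is sent to `x`, so by naturality its composite with `h` is sent to
    -- `X.map h x`.
    refine ⟨p.ι.app k ≫ h.hom, ?_⟩
    rw [← hdx, ← Functor.map_comp_apply]
    refine hy _ _ _ ?_
    rw [ha, ObjectProperty.FullSubcategory.comp_hom, ← Category.assoc, hd]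

end Definable

end DefinableCategories

theorem proposition3p2p2 {C : Type u} [Category.{w} C] [IsLocallyFinitelyPresentable.{w} C]
    (P : ObjectProperty C) (hP : DefinableCategories.IsDefinableSubcategory P)
    (X : DefinableCategories.Plus.{w} P.FullSubcategory) :
    ∃ (A : C) (_ : IsFinitelyPresentable.{w} A)
      (hA : DefinableCategories.PreservesProductsAndDirectedColimits.{w}
        (DefinableCategories.restrictedHom P A))
      (η : (⟨DefinableCategories.restrictedHom P A, hA⟩ :
        DefinableCategories.Plus.{w} P.FullSubcategory) ⟶ X),
      IsRegularEpi η ∧ ∀ L : P.FullSubcategory, Function.Surjective (η.hom.app L) := by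
  obtain ⟨A, hA, η, hη⟩ := hP.exists_surjective X.property
  exact ⟨A, hA, hP.preserves_restrictedHom hA, ObjectProperty.homMk η,
    DefinableCategories.isRegularEpi_of_surjective _ hη, hη⟩
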